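/- Let $k$ be a field of characteristic $p>0$, and let $P$ be a finite poset. Let $\bar P = P\cup\{-\infty\}$ be $P$ with a new least element added, and write $\bar P=\{v_0,v_1,\dots,v_d\}$ with $v_0=-\infty$ and $P=\{v_1,\dots,v_d\}$. Let $S=k[x_0,\dots,x_d]$, and let $R\subseteq S$ be the Hibi ring of $P$, i.e. the $k$-subalgebra generated by the monomials $x_0\prod_{v_i\in I}x_i$, where $I$ ranges over all poset ideals (down-closed subsets, including $\emptyset$) of $P$. Write $v_i\lessdot v_j$ when $v_j$ covers $v_i$ in $\bar P$. For a commutative ring $A$ of characteristic $p$ and $q=p^e$, a $p^{-e}$-linear map on $A$ is an additive map $\varphi$ on $A$, whose value at $x$ is written $\varphi(x^{1/q})$, such that $\varphi((a^qx)^{1/q})=a\,\varphi(x^{1/q})$ for all $a,x\in A$ (equivalently, for $A$ reduced, an $A$-linear map $A^{1/q}\to A$). Let $R^{\otimes n}$ be the $n$-fold tensor power of $R$ over $k$ and $\Delta_n:R^{\otimes n}\to R$ the multiplication map. Let $\mathcal D^{(n)}_e(R)$ be the set of $p^{-e}$-linear maps $\varphi$ on $R$ for which there is a $p^{-e}$-linear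 map $\widehat\varphi$ on $R^{\otimes n}$ with $\Delta_n(\widehat\varphi(x^{1/q}))=\varphi(\Delta_n(x)^{1/q})$ for all $x\in R^{\otimes n}$. Let $n,e\ge 1$ be integers and $q=p^e$. Let $r_0,\dots,r_d$ be nonnegative integers with $r_i>r_j$ whenever $v_i\lessdot v_j$, and with $q>r_i$ for all $i$. Put $z=\prod_{i=0}^d x_i^{r_i}$, which is an element of $R$. Then there exists $\varphi\in\mathcal D^{(n)}_e(R)$ with $\varphi(z^{1/q})=1$ if and only if the following holds. For all integers $\alpha_{i,m}\in[0,q-1]$ ($0\le i\le d$, $1\le m\le n$) such that $\sum_{m=1}^n\alpha_{j,m}\equiv r_j \pmod q$ for all $j$, there exist integers $\delta_{i,m}$ ($0\le i\le d$, $1\le m\le n$) with 1. $\delta_{i,m}\ge 0$ for all $m$ whenever $v_i$ is a maximal element of $P$; 2. $\delta_{j,m}\le \varepsilon_{j,i,m}+\delta_{i,m}$ for all $m$ whenever $v_i\lessdot v_j$ in $\bar P$, where $\varepsilon_{j,i,m}=1$ if $\alpha_{j,m}>\alpha_{i,m}$ and $\varepsilon_{j,i,m}=0$ otherwise; 3.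 $\sum_{m=1}^n\delta_{j,m}=N_j$ for all $j$, where $N_j=\left\lfloor\sum_{m=1}^n \alpha_{j,m}/q\right\rfloor$. -/

import Mathlib

open scoped TensorProduct

/-! ### Cartier maps and diagonal Cartier algebras -/

/-- A `q⁻¹`-linear map on a commutative ring `A`: an additive map with `φ (a ^ q * x) = a * φ x`.
When `q = p ^ e` and `A` has characteristic `p`, identifying `x ^ (1 / q)` with `x` turns these
into exactly the `A`-linear maps `A ^ (1 / q) → A`; under this identification, the value
at `x ^ (1 / q)` is `φ x`. -/
def IsRootLinear {A : Type*} [CommRing A] (q : ℕ) (φ : A →+ A) : Prop :=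
  ∀ a x : A, φ (a ^ q * x) = a * φ x

/-- The `n`-fold tensor power of the `k`-algebra `R` over `k`. -/
abbrev TensorPow (k R : Type*) [CommRing k] [CommRing R] [Algebra k R] (n : ℕ) : Type _ :=
  ⨂[k] _ : Fin n, R

/-- The multiplication map `R ⊗ ⋯ ⊗ R → R`, `x₁ ⊗ ⋯ ⊗ xₙ ↦ x₁ ⋯ xₙ`. -/
noncomputable def diagonalMap (k R : Type*) [CommRing k] [CommRing R] [Algebra k R] (n : ℕ) :
    TensorPow k R n →ₗ[k] R :=
  PiTensorProduct.lift (MultilinearMap.mkPiAlgebra k (Fin n) R)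

/-- The degree `e` part `𝒟⁽ⁿ⁾ₑ(R)` of the `n`-th diagonal Cartier algebra of `R` over `k`
(characteristic `p`): the `p⁻ᵉ`-linear maps on `R` which lift along the multiplication map to a
`p⁻ᵉ`-linear map on the `n`-fold tensor power of `R`. -/
def diagonalCartier (k R : Type*) [CommRing k] [CommRing R] [Algebra k R] (p n e : ℕ) :
    Set (R →+ R) :=
  {φ | IsRootLinear (p ^ e) φ ∧
    ∃ ψ : TensorPow k R n →+ TensorPow k R n, IsRootLinear (p ^ e) ψ ∧
      ∀ x, diagonalMap k R n (ψ x) = φ (diagonalMap k R n x)}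

/-! ### Hibi rings -/

open Classical in
/-- The generator `t * ∏_{v ∈ I} x_v` attached to a poset ideal (lower set) `I` of `P`.
The variables are indexed by `WithBot P`, i.e. `P` with a new least element `⊥`,
and `t` is the variable of index `⊥`. -/
noncomputable def hibiGenerator (k : Type*) [CommRing k] {P : Type*} [PartialOrder P] [Fintype P]
    (I : LowerSet P) : MvPolynomial (WithBot P) k :=
  MvPolynomial.X ⊥ * ∏ v ∈ Finset.univ.filter (fun v : P => v ∈ I), MvPolynomial.X (v : WithBot P)

/-- The Hibi ring of the finite poset `P` over `k`. -/
noncomputable def hibiRing (k : Type*) [CommRing k] (P : Type*) [PartialOrder P] [Fintype P] :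
    Subalgebra k (MvPolynomial (WithBot P) k) :=
  Algebra.adjoin k (Set.range (hibiGenerator k (P := P)))

theorem antitone_of_covBy_gt {P : Type*} [PartialOrder P] [Fintype P] {r : WithBot P → ℕ}
    (hr : ∀ i j : WithBot P, i ⋖ j → r j < r i) : Antitone r := by
  classical
  let _ : LocallyFiniteOrder (WithBot P) := Fintype.toLocallyFiniteOrder
  exact antitone_iff_forall_covBy r |>.2 fun i j h => (hr i j h).le

theorem prod_X_pow_mem_hibiRing (k : Type*) [CommRing k] {P : Type*} [PartialOrder P] [Fintype P]
    {r : WithBot P → ℕ} (hr : ∀ i j : WithBot P, i ⋖ j → r j < r i) :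
    ∏ i : WithBot P, (MvPolynomial.X i : MvPolynomial (WithBot P) k) ^ r i ∈ hibiRing k P := by
  classical
  have ha := antitone_of_covBy_gt hr
  let I : ℕ → LowerSet P := fun c =>
    ⟨{v | c < r v}, fun a b hab (h : c < r a) => lt_of_lt_of_le h (ha (by exact_mod_cast hab))⟩
  have key : ∏ i : WithBot P, (MvPolynomial.X i : MvPolynomial (WithBot P) k) ^ r i
      = ∏ c ∈ Finset.range (r ⊥), hibiGenerator k (I c) := by
    simp only [hibiGenerator, Finset.prod_mul_distrib, Finset.prod_const, Finset.card_range,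
      Finset.prod_filter]
    rw [Finset.prod_comm]
    have h1 : ∏ i : WithBot P, (MvPolynomial.X i : MvPolynomial (WithBot P) k) ^ r i
        = MvPolynomial.X ⊥ ^ r ⊥ * ∏ v : P, MvPolynomial.X (v : WithBot P) ^ r v :=
      Fintype.prod_option (fun i : Option P =>
        (MvPolynomial.X (i : WithBot P) : MvPolynomial (WithBot P) k) ^ r i)
    rw [h1]
    congr 1
    refine Finset.prod_congr rfl fun v _ => ?_
    rw [← Finset.prod_filter, Finset.prod_const]
    congr 1
    have : (Finset.range (r ⊥)).filter (fun c => v ∈ I c) = Finset.range (r v) := by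
      ext c
      have hv : r v ≤ r ⊥ := ha bot_le
      have hI : v ∈ I c ↔ c < r v := Iff.rfl
      simp only [Finset.mem_filter, Finset.mem_range, hI]
      omega
    rw [this, Finset.card_range]
  rw [key]
  exact Subalgebra.prod_mem _ fun c _ => Algebra.subset_adjoin ⟨I c, rfl⟩

/-- The element `z = ∏ x_i ^ r_i` of the Hibi ring, for exponents that strictly decrease along
the covering relations of `P` with a least element added. -/
noncomputable def hibiMonomial (k : Type*) [CommRing k] {P : Type*} [PartialOrder P] [Fintype P]
    (r : WithBot P → ℕ) (hr : ∀ i j : WithBot P, i ⋖ j → r j < r i) : hibiRing k P :=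
  ⟨∏ i : WithBot P, MvPolynomial.X i ^ r i, prod_X_pow_mem_hibiRing k hr⟩

/-!
Write `q = p ^ e`. The Hibi ring `R` is the monoid algebra of the antitone exponents
`WithBot P → ℕ`, so it has a basis of monomials (`hibiBasis`), and pure tensors of monomials form a
basis of its `n`-fold tensor power (`hibiTensorBasis`). Both bases are multiplicative, and the
multiplication map adds up the exponents of the factors. The cone of antitone exponents has the
facets `x_i = x_j` for `i ⋖ j`, and `x_i = 0` for `i` maximal.

If the shifts `δ` exist, choose one for each matrix `α` of residues modulo `q`. Sending the tensor
monomial with exponents `q B + α` to the one with exponents `B + δ` when the rows of `α` add up to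
`r` modulo `q`, and to zero otherwise, defines a `q⁻¹`-linear map on the tensor power: the
inequalities for `δ` say that `B + δ` is again in the cone (`exists_shifted_quotient`). It lifts the
map sending `x ^ (q F + r)` to `x ^ F` and all monomials of other shapes to zero
(`exists_mem_diagonalCartier`). Coefficients are handled by a splitting of the Frobenius of `k`
(`exists_isRootLinear_map_one`).

Conversely, let `ψ` lift `φ`, where `φ (x ^ r) = 1`. Apply `ψ` to the tensor monomial with exponents
`X = q h + α`, where `h` is a strictly antitone weight. Its image multiplies out to the monomial
with exponent `n h + N`, so some monomial in it has exponents `E` adding up to `n h + N`, and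
`δ = E - h` has the right sums. The inequalities for `δ` hold facet by facet: for a facet with linear
form `ℓ` and `ℓ (X) ≥ q t`, there are exponents `C`, `D`, `Y` in the cone with `ℓ (C) = t`,
`ℓ (D) = 0` and `q C + Y = q D + X`, which forces `D + E = C + E'` with `E'` in the cone, whence
`ℓ (E) ≥ t` (`IsRootLinear.exists_add_eq_add`, `IsRootLinear.le_exponent_of_isMax`,
`IsRootLinear.add_le_exponent_of_covBy`).
-/

/-! ### Root-linear maps on algebras with a monomial basis -/

/-- The Frobenius of a field splits: the field is a vector space over its subfield of `p ^ e`-th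
powers, and a linear projection onto that subfield, followed by the `p ^ e`-th root, is the
required map. No finiteness or perfectness of the field is needed. -/
theorem exists_isRootLinear_map_one (k : Type*) [Field k] (p e : ℕ) [Fact p.Prime] [CharP k p] :
    ∃ σ : k →+ k, σ 1 = 1 ∧ IsRootLinear (p ^ e) σ := by
  have : ExpChar k p := ExpChar.prime Fact.out
  let F : k →+* k := iterateFrobenius k p e
  have hF : ∀ x, F x = x ^ p ^ e := fun x => by simp [F, iterateFrobenius_def]
  let K := F.fieldRange
  obtain ⟨g, hg⟩ := (Algebra.linearMap K k).exists_leftInverse_of_injective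
    (LinearMap.ker_eq_bot.2 (algebraMap K k).injective)
  refine ⟨(F.rangeRestrictFieldEquiv.symm : K →+* k).toAddMonoidHom.comp g.toAddMonoidHom, ?_, ?_⟩
  · have : g 1 = 1 := by simpa using LinearMap.congr_fun hg 1
    simp [this]
  · intro a x
    have h1 : a ^ p ^ e * x = F.rangeRestrictFieldEquiv a • x := by
      rw [Subfield.smul_def, smul_eq_mul]
      simp [hF]
    simp [h1]

section MonomialBasis

variable {k A M : Type*} [Field k] [CommRing A] [Algebra k A]

/-- The additive map with `c • b a ↦ σ c • v a` for `c` in `k` and `a` in the index set of the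
basis `b`. -/
noncomputable def semilinearExtension (σ : k →+ k) (b : Module.Basis M k A) (v : M → A) : A →+ A :=
  (Finsupp.liftAddHom fun a => (LinearMap.toSpanSingleton k A (v a)).toAddMonoidHom.comp σ).comp
    b.repr.toLinearMap.toAddMonoidHom

theorem semilinearExtension_smul_basis (σ : k →+ k) (b : Module.Basis M k A) (v : M → A)
    (c : k) (a : M) : semilinearExtension σ b v (c • b a) = σ c • v a := by
  simp [semilinearExtension]

theorem Module.Basis.induction_add {b : Module.Basis M k A} {C : A → Prop} (x : A)
    (h0 : C 0) (hadd : ∀ x y, C x → C y → C (x + y)) (hb : ∀ (c : k) (a : M), C (c • b a)) : C x := by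
  obtain ⟨f, rfl⟩ := b.repr.symm.surjective x
  induction f using Finsupp.induction_linear with
  | zero => simpa using h0
  | add f g hf hg => simpa using hadd _ _ hf hg
  | single a c => simpa using hb c a

/-- A linear map which sends basis elements to basis elements can only produce a given basis
element from a basis element that lies over it. -/
theorem exists_of_repr_map_ne_zero {B N : Type*} [CommRing B] [Algebra k B]
    {b : Module.Basis M k A} {b' : Module.Basis N k B} {f : A →ₗ[k] B}
    {s : M → N} (hb : ∀ a, f (b a) = b' (s a)) {y : A} {G : N} (h : b'.repr (f y) G ≠ 0) :
    ∃ E, b.repr y E ≠ 0 ∧ s E = G := by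
  classical
  contrapose! h
  have : f y = (b.repr y).sum fun E c => c • b' (s E) := by
    conv_lhs => rw [← b.linearCombination_repr y]
    simp [Finsupp.linearCombination_apply, Finsupp.sum, hb]
  rw [this, Finsupp.sum, map_sum, Finsupp.finsetSum_apply]
  refine Finset.sum_eq_zero fun E hE => ?_
  simp [h E (Finsupp.mem_support_iff.1 hE)]

theorem map_semilinearExtension {B N : Type*} [CommRing B] [Algebra k B] {σ : k →+ k}
    {b : Module.Basis M k A} {v : M → A} {b' : Module.Basis N k B} {v' : N → B} {f : A →ₗ[k] B}
    {s : M → N} (hb : ∀ a, f (b a) = b' (s a)) (hv : ∀ a, f (v a) = v' (s a)) (x : A) :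
    f (semilinearExtension σ b v x) = semilinearExtension σ b' v' (f x) := by
  induction x using Module.Basis.induction_add (b := b) with
  | h0 => simp
  | hadd x y hx hy => simp [hx, hy]
  | hb c a => simp [semilinearExtension_smul_basis, hb, hv]

variable [AddCommMonoid M]

theorem basis_nsmul {b : Module.Basis M k A} (h0 : b 0 = 1) (hb : ∀ a c, b (a + c) = b a * b c)
    (q : ℕ) (a : M) : b (q • a) = b a ^ q := by
  induction q with
  | zero => simp [h0]
  | succ q ih => rw [succ_nsmul, hb, ih, pow_succ]

theorem isRootLinear_semilinearExtension (p e : ℕ) [Fact p.Prime] [CharP k p] {σ : k →+ k}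
    (hσ : IsRootLinear (p ^ e) σ) {b : Module.Basis M k A} (h0 : b 0 = 1)
    (hb : ∀ a c, b (a + c) = b a * b c) {v : M → A}
    (hv : ∀ C a, v (p ^ e • C + a) = b C * v a) :
    IsRootLinear (p ^ e) (semilinearExtension σ b v) := by
  have : Nontrivial A := ⟨b 0, 0, b.ne_zero 0⟩
  have : CharP A p := charP_of_injective_algebraMap (algebraMap k A).injective p
  have : ExpChar A p := ExpChar.prime Fact.out
  intro f x
  induction f using Module.Basis.induction_add (b := b) with
  | h0 => simp [(Fact.out : p.Prime).ne_zero]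
  | hadd f g hf hg => rw [add_pow_expChar_pow, add_mul, map_add, hf, hg, add_mul]
  | hb c C =>
    induction x using Module.Basis.induction_add (b := b) with
    | h0 => simp
    | hadd x y hx hy => rw [mul_add, map_add, hx, hy, map_add, mul_add]
    | hb d a =>
      rw [smul_pow, ← basis_nsmul h0 hb, smul_mul_smul_comm, ← hb, semilinearExtension_smul_basis,
        semilinearExtension_smul_basis, hσ, hv, smul_mul_smul_comm]

/-- Root-linear maps may be prescribed on monomials, compatibly with multiplication by `q`-th
powers of monomials; a lift along a linear map need only be checked on monomials. -/
theorem exists_isRootLinear_lift {B N : Type*} [CommRing B] [Algebra k B] [AddCommMonoid N]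
    (p e : ℕ) [Fact p.Prime] [CharP k p]
    {b : Module.Basis M k A} {v : M → A} {b' : Module.Basis N k B} {w : N → B} {f : A →ₗ[k] B}
    {s : M → N} (h0 : b 0 = 1) (hb : ∀ a c, b (a + c) = b a * b c)
    (h0' : b' 0 = 1) (hb' : ∀ a c, b' (a + c) = b' a * b' c) (hf : ∀ a, f (b a) = b' (s a))
    (hv : ∀ C a, v (p ^ e • C + a) = b C * v a) (hw : ∀ C a, w (p ^ e • C + a) = b' C * w a)
    (hvw : ∀ a, f (v a) = w (s a)) :
    ∃ φ : B →+ B, IsRootLinear (p ^ e) φ ∧ ∃ ψ : A →+ A, IsRootLinear (p ^ e) ψ ∧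
      (∀ x, f (ψ x) = φ (f x)) ∧ ∀ a, φ (b' a) = w a := by
  obtain ⟨σ, hσ1, hσ⟩ := exists_isRootLinear_map_one k p e
  refine ⟨semilinearExtension σ b' w, isRootLinear_semilinearExtension p e hσ h0' hb' hw,
    semilinearExtension σ b v, isRootLinear_semilinearExtension p e hσ h0 hb hv,
    map_semilinearExtension hf hvw, fun a => ?_⟩
  rw [← one_smul k (b' a), semilinearExtension_smul_basis, hσ1, one_smul]

theorem repr_basis_mul [IsCancelAdd M] {b : Module.Basis M k A}
    (hb : ∀ a c, b (a + c) = b a * b c) (D E : M) (y : A) :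
    b.repr (b D * y) (D + E) = b.repr y E := by
  classical
  induction y using Module.Basis.induction_add (b := b) with
  | h0 => simp
  | hadd x y hx hy => simp [mul_add, hx, hy]
  | hb c a => simp [← hb, Finsupp.single_apply]

theorem exists_of_repr_basis_mul_ne_zero {b : Module.Basis M k A}
    (hb : ∀ a c, b (a + c) = b a * b c) {C G : M} {y : A}
    (h : b.repr (b C * y) G ≠ 0) : ∃ E, G = C + E := by
  classical
  contrapose! h
  induction y using Module.Basis.induction_add (b := b) with
  | h0 => simp
  | hadd x y hx hy => simp [mul_add, hx, hy]
  | hb c a =>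
    simp only [mul_smul_comm, ← hb, map_smul, Module.Basis.repr_self, Finsupp.smul_single,
      Finsupp.single_apply]
    rw [if_neg fun h' => h a h'.symm]

/-- The exponents occurring in the image of a monomial under a root-linear map: the relation
`q C + A' = q D + A` between exponents gives `b D * ψ (b A) = b C * ψ (b A')`. -/
theorem IsRootLinear.exists_add_eq_add [IsCancelAdd M] {q : ℕ} {ψ : A →+ A}
    (hψ : IsRootLinear q ψ) {b : Module.Basis M k A} (h0 : b 0 = 1)
    (hb : ∀ a c, b (a + c) = b a * b c) {X X' C D E : M} (h : q • C + X' = q • D + X)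
    (hE : b.repr (ψ (b X)) E ≠ 0) : ∃ E', D + E = C + E' := by
  apply exists_of_repr_basis_mul_ne_zero hb (y := ψ (b X'))
  rwa [← hψ, ← basis_nsmul h0 hb, ← hb, h, hb, basis_nsmul h0 hb, hψ, repr_basis_mul hb]

end MonomialBasis

/-! ### The monomial basis of a Hibi ring and of its tensor powers -/

theorem monomial_equivFunOnFinite_symm (k : Type*) [Field k] {ι : Type*} [Fintype ι] (a : ι → ℕ) :
    MvPolynomial.monomial (Finsupp.equivFunOnFinite.symm a) (1 : k) =
      ∏ i : ι, MvPolynomial.X i ^ a i := by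
  rw [MvPolynomial.monomial_eq, Finsupp.prod_fintype _ _ (by simp)]
  simp

section Hibi

variable (P : Type*) [PartialOrder P]

/-- The exponents of the monomials in the Hibi ring of `P`. -/
def hibiMonoid : AddSubmonoid (WithBot P → ℕ) where
  carrier := {a | Antitone a}
  zero_mem' := antitone_const
  add_mem' ha hb := ha.add hb

variable {P}

theorem hibiMonoid_sum_apply {n : ℕ} (A : Fin n → hibiMonoid P) (l : WithBot P) :
    (∑ m, A m).1 l = ∑ m, (A m).1 l := by
  rw [AddSubmonoid.coe_finsetSum, Finset.sum_apply]

variable [Fintype P] (k : Type*) [Field k]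

/-- A monomial with antitone exponent `a` is the product of the generators attached to the
superlevel sets `{v | c < a v}`, for `c < a ⊥`. -/
theorem prod_X_pow_mem_hibiRing_of_antitone {a : WithBot P → ℕ} (ha : Antitone a) :
    ∏ i : WithBot P, (MvPolynomial.X i : MvPolynomial (WithBot P) k) ^ a i ∈ hibiRing k P := by
  classical
  let I : ℕ → LowerSet P := fun c =>
    ⟨{v | c < a v}, fun _ _ huv h => lt_of_lt_of_le h (ha (WithBot.coe_le_coe.2 huv))⟩
  have key : ∏ i : WithBot P, (MvPolynomial.X i : MvPolynomial (WithBot P) k) ^ a i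
      = ∏ c ∈ Finset.range (a ⊥), hibiGenerator k (I c) := by
    simp only [hibiGenerator, Finset.prod_mul_distrib, Finset.prod_const, Finset.card_range,
      Finset.prod_filter]
    rw [Finset.prod_comm]
    refine (Fintype.prod_option fun i : Option P =>
      (MvPolynomial.X (i : WithBot P) : MvPolynomial (WithBot P) k) ^ a i).trans ?_
    congr 1
    refine Finset.prod_congr rfl fun v _ => ?_
    rw [← Finset.prod_filter, Finset.prod_const]
    congr 1
    have : (Finset.range (a ⊥)).filter (fun c => v ∈ I c) = Finset.range (a v) := by
      ext c
      have hv : a v ≤ a ⊥ := ha bot_le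
      have hI : v ∈ I c ↔ c < a v := Iff.rfl
      simp only [Finset.mem_filter, Finset.mem_range, hI]
      omega
    rw [this, Finset.card_range]
    rfl
  rw [key]
  exact Subalgebra.prod_mem _ fun c _ => Algebra.subset_adjoin ⟨I c, rfl⟩

/-- The monomial with exponent `a`, as an element of the Hibi ring. -/
noncomputable def hibiMonomialOf (a : hibiMonoid P) : hibiRing k P :=
  ⟨∏ i : WithBot P, MvPolynomial.X i ^ a.1 i, prod_X_pow_mem_hibiRing_of_antitone k a.2⟩

theorem hibiMonomialOf_zero : hibiMonomialOf k (0 : hibiMonoid P) = 1 :=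
  Subtype.ext <| by simp [hibiMonomialOf]

theorem hibiMonomialOf_add (a c : hibiMonoid P) :
    hibiMonomialOf k (a + c) = hibiMonomialOf k a * hibiMonomialOf k c :=
  Subtype.ext <| by simp [hibiMonomialOf, pow_add, Finset.prod_mul_distrib]

theorem linearIndependent_hibiMonomialOf :
    LinearIndependent k (hibiMonomialOf k : hibiMonoid P → hibiRing k P) := by
  apply LinearIndependent.of_comp (hibiRing k P).val.toLinearMap
  have h := (MvPolynomial.basisMonomials (WithBot P) k).linearIndependent.comp
    (fun a : hibiMonoid P => Finsupp.equivFunOnFinite.symm a.1)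
    (Finsupp.equivFunOnFinite.symm.injective.comp Subtype.val_injective)
  have hcomp : (hibiRing k P).val.toLinearMap ∘ hibiMonomialOf k =
      MvPolynomial.basisMonomials (WithBot P) k ∘
        fun a : hibiMonoid P => Finsupp.equivFunOnFinite.symm a.1 := by
    funext a
    simp [hibiMonomialOf, monomial_equivFunOnFinite_symm]
  rw [hcomp]
  exact h

theorem span_hibiMonomialOf :
    ⊤ ≤ Submodule.span k (Set.range (hibiMonomialOf k : hibiMonoid P → hibiRing k P)) := by
  classical
  rintro ⟨x, hx⟩ -
  induction hx using Algebra.adjoin_induction with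
  | mem x hx =>
    obtain ⟨I, rfl⟩ := hx
    let a : WithBot P → ℕ := fun i => WithBot.recBotCoe 1 (fun v => if v ∈ I then 1 else 0) i
    have ha : Antitone a := by
      intro i j hij
      induction j with
      | bot => simp [le_bot_iff.1 hij]
      | coe v =>
        induction i with
        | bot => simp only [a, WithBot.recBotCoe_bot, WithBot.recBotCoe_coe]; split_ifs <;> simp
        | coe u =>
          have := I.lower (WithBot.coe_le_coe.1 hij)
          simp only [a, WithBot.recBotCoe_coe]
          split_ifs <;> simp_all
    refine Submodule.subset_span ⟨⟨a, ha⟩, Subtype.ext ?_⟩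
    refine (Fintype.prod_option fun i : Option P =>
      (MvPolynomial.X (i : WithBot P) : MvPolynomial (WithBot P) k) ^ a i).trans ?_
    simp only [hibiGenerator, Finset.prod_filter]
    refine congrArg₂ _ (pow_one _) (Finset.prod_congr rfl fun v _ => ?_)
    change (MvPolynomial.X (v : WithBot P) : MvPolynomial (WithBot P) k) ^
      (if v ∈ I then 1 else 0) = _
    split_ifs <;> simp
  | algebraMap c =>
    have : (⟨algebraMap k _ c, (hibiRing k P).algebraMap_mem c⟩ : hibiRing k P)
        = c • hibiMonomialOf k (0 : hibiMonoid P) := by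
      rw [hibiMonomialOf_zero, ← Algebra.algebraMap_eq_smul_one]
      rfl
    exact this ▸ Submodule.smul_mem _ c (Submodule.subset_span ⟨0, rfl⟩)
  | add x y hx hy hx' hy' => exact Submodule.add_mem _ hx' hy'
  | mul x y hx hy hx' hy' =>
    have h := Submodule.mul_mem_mul hx' hy'
    rw [Submodule.span_mul_span] at h
    refine Submodule.span_mono ?_ h
    rintro _ ⟨_, ⟨a, rfl⟩, _, ⟨c, rfl⟩, rfl⟩
    exact ⟨a + c, hibiMonomialOf_add k a c⟩

/-- The basis of the Hibi ring consisting of the monomials with antitone exponents. -/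
noncomputable def hibiBasis : Module.Basis (hibiMonoid P) k (hibiRing k P) :=
  .mk (linearIndependent_hibiMonomialOf k) (span_hibiMonomialOf k)

theorem hibiBasis_apply (a : hibiMonoid P) : hibiBasis k a = hibiMonomialOf k a := by
  simp [hibiBasis]

theorem hibiBasis_zero : hibiBasis k (0 : hibiMonoid P) = 1 := by
  rw [hibiBasis_apply, hibiMonomialOf_zero]

theorem hibiBasis_add (a c : hibiMonoid P) :
    hibiBasis k (a + c) = hibiBasis k a * hibiBasis k c := by
  simp only [hibiBasis_apply, hibiMonomialOf_add]

variable (P) in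
/-- The basis of the tensor power of the Hibi ring consisting of the pure tensors of monomials. -/
noncomputable def hibiTensorBasis (n : ℕ) :
    Module.Basis (Fin n → hibiMonoid P) k (TensorPow k (hibiRing k P) n) :=
  Basis.piTensorProduct fun _ => hibiBasis k

variable {n : ℕ}

theorem hibiTensorBasis_zero : hibiTensorBasis P k n 0 = 1 := by
  simp only [hibiTensorBasis, Basis.piTensorProduct_apply, Pi.zero_apply, hibiBasis_zero]
  rfl

theorem hibiTensorBasis_add (a c : Fin n → hibiMonoid P) :
    hibiTensorBasis P k n (a + c) = hibiTensorBasis P k n a * hibiTensorBasis P k n c := by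
  simp only [hibiTensorBasis, Basis.piTensorProduct_apply, PiTensorProduct.tprod_mul_tprod,
    Pi.add_apply, hibiBasis_add]
  rfl

theorem diagonalMap_hibiTensorBasis (a : Fin n → hibiMonoid P) :
    diagonalMap k (hibiRing k P) n (hibiTensorBasis P k n a) = hibiBasis k (∑ m, a m) := by
  have h : ∀ s : Finset (Fin n), ∏ m ∈ s, hibiBasis k (a m) = hibiBasis k (∑ m ∈ s, a m) := by
    intro s
    induction s using Finset.cons_induction with
    | empty => simp [hibiBasis_zero]
    | cons i s hi ih => rw [Finset.prod_cons, Finset.sum_cons, ih, hibiBasis_add]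
  simp [hibiTensorBasis, diagonalMap, h]

end Hibi

/-! ### From a lift to the combinatorial condition -/

section Necessity

variable {P : Type*} [PartialOrder P] [Fintype P] {k : Type*} [Field k] {n q : ℕ}
  {ψ : TensorPow k (hibiRing k P) n →+ TensorPow k (hibiRing k P) n}
  {X E : Fin n → hibiMonoid P}

theorem IsRootLinear.exists_hibi_add_eq_add (hψ : IsRootLinear q ψ)
    (hE : (hibiTensorBasis P k n).repr (ψ (hibiTensorBasis P k n X)) E ≠ 0) (m : Fin n)
    {C D Y : hibiMonoid P} (h : q • C + Y = q • D + X m) : ∃ E', D + E m = C + E' := by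
  have h' : q • Pi.single m C + Function.update X m Y = q • Pi.single m D + X := by
    funext m'
    by_cases hm : m' = m
    · subst hm
      simpa using h
    · simp [hm]
  obtain ⟨E', hE'⟩ := hψ.exists_add_eq_add (hibiTensorBasis_zero k) (hibiTensorBasis_add k) h' hE
  exact ⟨E' m, by simpa using congrFun hE' m⟩

/-- The inequality for the exponents `E` occurring in the image of the monomial
`X` at a facet `x_i = 0` of the cone, with `i`
maximal. -/
theorem IsRootLinear.le_exponent_of_isMax (hψ : IsRootLinear q ψ)
    (hE : (hibiTensorBasis P k n).repr (ψ (hibiTensorBasis P k n X)) E ≠ 0) (m : Fin n)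
    {i : WithBot P} (hi : IsMax i) {t : ℕ} (ht : q * t ≤ (X m).1 i) : t ≤ (E m).1 i := by
  classical
  -- `C` has `i`-th entry `t`, and `D` lies on the facet and agrees with `C` off `i`.
  let C : hibiMonoid P := ⟨fun _ => t, antitone_const⟩
  let D : hibiMonoid P := ⟨fun l => if l = i then 0 else t, by
    intro l l' hl
    by_cases h : l = i
    · have : l' = i := (hi.eq_of_le (h ▸ hl)).symm
      simp [this]
    · simp only [h, if_false]
      split_ifs <;> simp⟩
  have hY : Antitone fun l => q * D.1 l + (X m).1 l - q * t := fun l l' hl =>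
    Nat.sub_le_sub_right (Nat.add_le_add (Nat.mul_le_mul_left q (D.2 hl)) ((X m).2 hl)) _
  obtain ⟨E', hE'⟩ := hψ.exists_hibi_add_eq_add hE m (C := C) (D := D) (Y := ⟨_, hY⟩) (by
    apply Subtype.ext
    funext l
    change q * t + (q * D.1 l + (X m).1 l - q * t) = q * D.1 l + (X m).1 l
    apply Nat.add_sub_cancel'
    by_cases h : l = i
    · exact h ▸ ht.trans (Nat.le_add_left _ _)
    · simp [D, h])
  have h := congrFun (congrArg Subtype.val hE') i
  change (if i = i then 0 else t) + (E m).1 i = t + E'.1 i at h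
  simp only [if_true] at h
  omega

open Classical in
/-- The exponent which at `l` counts the lower sets of the form `{l | l ≤ u}`, each of them
enlarged by `{l | l ≤ j}` when it contains `i`. For `i ⋖ j` it lies in the relative interior of
the facet `x_i = x_j` of the cone of antitone exponents. -/
noncomputable def facetWeight (i j l : WithBot P) : ℕ :=
  (Finset.univ.filter fun u : WithBot P => l ≤ u ∨ (i ≤ u ∧ l ≤ j)).card

theorem facetWeight_antitone (i j : WithBot P) : Antitone (facetWeight i j) := fun l l' hl =>
  Finset.card_le_card fun u => by
    simp only [Finset.mem_filter, Finset.mem_univ, true_and]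
    exact Or.imp hl.trans (And.imp_right hl.trans)

theorem facetWeight_pos (i j l : WithBot P) : 0 < facetWeight i j l :=
  Finset.card_pos.2 ⟨l, by simp⟩

theorem facetWeight_eq {i j : WithBot P} (h : i ≤ j) : facetWeight i j i = facetWeight i j j := by
  unfold facetWeight
  congr 1
  ext u
  simp only [Finset.mem_filter, Finset.mem_univ, true_and, h, le_refl, and_true]
  exact ⟨fun hu => hu.elim Or.inr Or.inr, fun hu => hu.elim (fun hu => Or.inl (h.trans hu)) Or.inl⟩

theorem facetWeight_lt {i j l l' : WithBot P} (hij : i ⋖ j) (hl : l < l')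
    (h : ¬(l = i ∧ l' = j)) : facetWeight i j l' < facetWeight i j l := by
  classical
  apply Finset.card_lt_card
  rw [Finset.ssubset_iff_of_subset fun u => by
    simp only [Finset.mem_filter, Finset.mem_univ, true_and]
    exact Or.imp hl.le.trans (And.imp_right hl.le.trans)]
  refine ⟨l, by simp, ?_⟩
  simp only [Finset.mem_filter, Finset.mem_univ, true_and, not_or, not_and]
  refine ⟨hl.not_ge, fun hil hlj => ?_⟩
  rcases hil.eq_or_lt with rfl | hil
  · rcases hlj.eq_or_lt with rfl | hlj
    · exact h ⟨rfl, rfl⟩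
    · exact hij.2 hl hlj
  · exact hij.2 hil (hl.trans_le hlj)

/-- The inequality for the exponents `E` occurring in the image of the monomial
`X` at a facet `x_i = x_j` of the cone. -/
theorem IsRootLinear.add_le_exponent_of_covBy (hψ : IsRootLinear q ψ)
    (hE : (hibiTensorBasis P k n).repr (ψ (hibiTensorBasis P k n X)) E ≠ 0) (m : Fin n)
    {i j : WithBot P} (hij : i ⋖ j) {t : ℕ} (ht : q * t + (X m).1 j ≤ (X m).1 i) :
    t + (E m).1 j ≤ (E m).1 i := by
  classical
  let g := facetWeight i j
  -- `C` has value `t` under `x_i - x_j`. Adding `q D` compensates for subtracting `q C`: on all other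
  -- pairs `D` drops by at least `t`, and on the pair `i`, `j`, where `D` is constant, `X` drops enough.
  let C : hibiMonoid P := ⟨fun l => if l ≤ i then t else 0, fun l l' hl => by
    dsimp only
    split_ifs with h h' <;> first | exact (h' (hl.trans h)).elim | simp⟩
  let D : hibiMonoid P := ⟨fun l => t * g l, fun l l' hl =>
    Nat.mul_le_mul_left t (facetWeight_antitone i j hl)⟩
  have hCD : ∀ l, C.1 l ≤ D.1 l := fun l => by
    have := Nat.mul_le_mul_left t (facetWeight_pos i j l)
    change (if l ≤ i then t else 0) ≤ t * facetWeight i j l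
    split_ifs <;> omega
  have hji : ¬ j ≤ i := hij.lt.not_ge
  have hg : g i = g j := facetWeight_eq hij.le
  have hY : Antitone fun l => q * D.1 l + (X m).1 l - q * C.1 l := by
    intro l l' hl
    rcases hl.eq_or_lt with rfl | hl
    · exact le_rfl
    dsimp only
    have h1 := (X m).2 hl.le
    have h2 := Nat.mul_le_mul_left q (hCD l)
    have h3 := Nat.mul_le_mul_left q (hCD l')
    by_cases h : l = i ∧ l' = j
    · obtain ⟨rfl, rfl⟩ := h
      have hCi : C.1 l = t := if_pos le_rfl
      have hCj : C.1 l' = 0 := if_neg hji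
      have hD : D.1 l = D.1 l' := congrArg (t * ·) hg
      rw [hCi, hCj, hD]
      omega
    · have hD : D.1 l' + C.1 l ≤ D.1 l := by
        have h4 := Nat.mul_le_mul_left t (facetWeight_lt hij hl h)
        rw [Nat.mul_succ] at h4
        have h5 : C.1 l ≤ t := by
          change (if l ≤ i then t else 0) ≤ t
          split_ifs <;> simp
        exact (Nat.add_le_add_left h5 _).trans h4
      have h6 := Nat.mul_le_mul_left q hD
      rw [Nat.mul_add] at h6
      change (X m).1 l' ≤ (X m).1 l at h1
      omega
  obtain ⟨E', hE'⟩ := hψ.exists_hibi_add_eq_add hE m (C := C) (D := D) (Y := ⟨_, hY⟩) (by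
    apply Subtype.ext
    funext l
    change q * C.1 l + (q * D.1 l + (X m).1 l - q * C.1 l) = q * D.1 l + (X m).1 l
    have := Nat.mul_le_mul_left q (hCD l)
    omega)
  have h1 := congrFun (congrArg Subtype.val hE') i
  have h2 := congrFun (congrArg Subtype.val hE') j
  change t * g i + (E m).1 i = (if i ≤ i then t else 0) + E'.1 i at h1
  change t * g j + (E m).1 j = (if j ≤ i then t else 0) + E'.1 j at h2
  have h3 : E'.1 j ≤ E'.1 i := E'.2 hij.le
  rw [if_pos le_rfl, hg] at h1
  rw [if_neg hji] at h2
  omega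

open Classical in
/-- The number of elements above `l`, a strictly antitone exponent. -/
noncomputable def coheightWeight (l : WithBot P) : ℕ :=
  (Finset.univ.filter fun u : WithBot P => l ≤ u).card

theorem coheightWeight_strictAnti : StrictAnti (coheightWeight (P := P)) := fun l l' hl => by
  classical
  apply Finset.card_lt_card
  rw [Finset.ssubset_iff_of_subset fun u => by
    simpa only [Finset.mem_filter, Finset.mem_univ, true_and] using hl.le.trans]
  exact ⟨l, by simp, by simpa using hl.not_ge⟩

/-- The shifts are read off from a monomial in the image under the lift of the monomial with
exponents `q h + α`, where `h` is strictly antitone. -/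
theorem exists_shift_of_mem_diagonalCartier {p e : ℕ} {r : hibiMonoid P}
    (hr : ∀ i, r.1 i < p ^ e)
    {φ : hibiRing k P →+ hibiRing k P} (hφ : φ ∈ diagonalCartier k (hibiRing k P) p n e)
    (hφr : φ (hibiBasis k r) = 1) (α : WithBot P → Fin n → ℤ)
    (hα : ∀ i m, 0 ≤ α i m ∧ α i m < (p ^ e : ℕ))
    (hαr : ∀ j, ∑ m, α j m ≡ (r.1 j : ℤ) [ZMOD (p ^ e : ℕ)]) :
    ∃ δ : WithBot P → Fin n → ℤ, (∀ i, IsMax i → ∀ m, 0 ≤ δ i m) ∧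
      (∀ i j : WithBot P, i ⋖ j → ∀ m, δ j m ≤ (if α i m < α j m then 1 else 0) + δ i m) ∧
      ∀ j, ((p ^ e : ℕ) : ℤ) * ∑ m, δ j m + r.1 j = ∑ m, α j m := by
  obtain ⟨hφl, ψ, hψ, hψφ⟩ := hφ
  set q := p ^ e
  lift α to WithBot P → Fin n → ℕ using fun i m => (hα i m).1
  beta_reduce at hα hαr ⊢
  replace hα : ∀ i m, α i m < q := fun i m => by exact_mod_cast (hα i m).2
  -- `q h` drops by at least `q` at each step, so it stays antitone after adding the residues `α`;
  -- likewise for `n h` and the carries, which are at most `n`.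
  let h := coheightWeight (P := P)
  have hh : StrictAnti h := coheightWeight_strictAnti
  have hN : ∀ j, q * ((∑ m, α j m) / q) + r.1 j = ∑ m, α j m := fun j => by
    have h1 : ∑ m, α j m ≡ r.1 j [MOD q] := by
      rw [← Int.natCast_modEq_iff]
      exact_mod_cast hαr j
    have h2 : (∑ m, α j m) % q = r.1 j := Nat.mod_eq_of_modEq h1 (hr j)
    have := Nat.div_add_mod (∑ m, α j m) q
    omega
  let N : WithBot P → ℕ := fun j => (∑ m, α j m) / q
  have hNn : ∀ j, N j ≤ n := fun j => by
    refine Nat.div_le_of_le_mul ?_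
    calc ∑ m, α j m ≤ ∑ _m : Fin n, q := Finset.sum_le_sum fun m _ => (hα j m).le
      _ = q * n := by simp [mul_comm]
  let X : Fin n → hibiMonoid P := fun m => ⟨fun l => q * h l + α l m, fun l l' hl => by
    rcases hl.eq_or_lt with rfl | hl
    · exact le_rfl
    have h1 := Nat.mul_le_mul_left q (hh hl)
    rw [Nat.mul_succ] at h1
    have := hα l' m
    dsimp only
    omega⟩
  let G : hibiMonoid P := ⟨fun l => n * h l + N l, fun l l' hl => by
    rcases hl.eq_or_lt with rfl | hl
    · exact le_rfl
    have h1 := Nat.mul_le_mul_left n (hh hl)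
    rw [Nat.mul_succ] at h1
    have := hNn l'
    dsimp only
    omega⟩
  have hXG : ∑ m, X m = q • G + r := by
    apply Subtype.ext
    funext l
    rw [hibiMonoid_sum_apply]
    change ∑ m, (q * h l + α l m) = q * (n * h l + N l) + r.1 l
    rw [Finset.sum_add_distrib, ← hN l]
    simp [N]
    ring
  have himage : diagonalMap k (hibiRing k P) n (ψ (hibiTensorBasis P k n X)) = hibiBasis k G := by
    rw [hψφ, diagonalMap_hibiTensorBasis, hXG, hibiBasis_add,
      basis_nsmul (hibiBasis_zero k) (hibiBasis_add k), hφl, hφr, mul_one]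
  obtain ⟨E, hE, hEG⟩ := exists_of_repr_map_ne_zero (b := hibiTensorBasis P k n)
    (diagonalMap_hibiTensorBasis k)
    (show (hibiBasis k).repr (diagonalMap k (hibiRing k P) n (ψ (hibiTensorBasis P k n X))) G ≠ 0 by
      rw [himage]; simp)
  refine ⟨fun l m => ((E m).1 l : ℤ) - h l, fun i hi m => ?_, fun i j hij m => ?_, fun j => ?_⟩
  · have : h i ≤ (E m).1 i := hψ.le_exponent_of_isMax hE m hi (Nat.le_add_right _ _)
    dsimp only
    omega
  · have h1 : h j < h i := hh hij.lt
    obtain ⟨s, hs⟩ := Nat.exists_eq_add_of_lt h1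
    by_cases hij' : α i m < α j m
    · have h2 : s + (E m).1 j ≤ (E m).1 i := hψ.add_le_exponent_of_covBy hE m hij (by
        change q * s + (q * h j + α j m) ≤ q * h i + α i m
        rw [hs]
        have := hα j m
        linarith)
      dsimp only
      rw [if_pos (by exact_mod_cast hij')]
      omega
    · have h2 : s + 1 + (E m).1 j ≤ (E m).1 i := hψ.add_le_exponent_of_covBy hE m hij (by
        change q * (s + 1) + (q * h j + α j m) ≤ q * h i + α i m
        rw [hs]
        linarith)
      dsimp only
      rw [if_neg (by exact_mod_cast hij')]
      omega
  · have h1 : ∑ m, (E m).1 j = n * h j + N j := by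
      rw [← hibiMonoid_sum_apply, hEG]
    have h2 : ∑ m, (((E m).1 j : ℤ) - h j) = N j := by
      rw [Finset.sum_sub_distrib, ← Nat.cast_sum, h1]
      simp
    rw [h2]
    exact_mod_cast hN j

end Necessity

/-! ### From the combinatorial condition to a lift -/

section Sufficiency

variable {P : Type*} [PartialOrder P]

theorem antitone_of_forall_covBy [Fintype P] {a : WithBot P → ℤ}
    (h : ∀ i j : WithBot P, i ⋖ j → a j ≤ a i) : Antitone a := by
  classical
  let _ : LocallyFiniteOrder (WithBot P) := Fintype.toLocallyFiniteOrder
  exact antitone_iff_forall_covBy a |>.2 fun i j hij => h i j hij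

theorem exists_hibiMonoid_coe_eq [Fintype P] {a : WithBot P → ℤ} (ha : Antitone a)
    (h0 : ∀ i, IsMax i → 0 ≤ a i) : ∃ E : hibiMonoid P, ∀ i, (E.1 i : ℤ) = a i := by
  have hpos : ∀ i, 0 ≤ a i := fun i => by
    obtain ⟨j, hij, hj⟩ := (Set.toFinite (Set.univ : Set (WithBot P))).exists_le_maximal
      (Set.mem_univ i)
    exact (h0 j fun b hb => hj.2 (Set.mem_univ b) hb).trans (ha hij)
  exact ⟨⟨fun i => (a i).toNat, fun i j hij => Int.toNat_le_toNat (ha hij)⟩,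
    fun i => Int.toNat_of_nonneg (hpos i)⟩

/-- The exponent `a` is entrywise congruent to `r` modulo `q`. -/
def IsCongruentTo (q : ℕ) (r a : hibiMonoid P) : Prop := ∀ i, a.1 i ≡ r.1 i [MOD q]

theorem isCongruentTo_nsmul_add_iff {q : ℕ} {r C a : hibiMonoid P} :
    IsCongruentTo q r (q • C + a) ↔ IsCongruentTo q r a := forall_congr' fun i => by
  change q * C.1 i + a.1 i ≡ r.1 i [MOD q] ↔ _
  simp [Nat.ModEq]

/-- An exponent congruent to `r` modulo `q` is `q F + r` for an exponent `F`, namely the entrywise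
quotient: the entries of `r` are less than `q`. -/
theorem IsCongruentTo.exists_eq_nsmul_add {q : ℕ} {r a : hibiMonoid P}
    (ha : IsCongruentTo q r a) (hrq : ∀ i, r.1 i < q) : ∃ F : hibiMonoid P, a = q • F + r := by
  have h : ∀ i, q * (a.1 i / q) + r.1 i = a.1 i := fun i => by
    have h2 : a.1 i % q = r.1 i := Nat.mod_eq_of_modEq (ha i) (hrq i)
    have := Nat.div_add_mod (a.1 i) q
    omega
  exact ⟨⟨fun i => a.1 i / q, fun i j hij => Nat.div_le_div_right (a.2 hij)⟩,
    Subtype.ext (funext fun i => (h i).symm)⟩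

theorem nsmul_add_right_injective {q : ℕ} (hq : 0 < q) (r : hibiMonoid P) :
    Function.Injective fun F : hibiMonoid P => q • F + r := fun F F' h => by
  apply Subtype.ext
  funext i
  have h1 : q * F.1 i + r.1 i = q * F'.1 i + r.1 i := congrFun (congrArg Subtype.val h) i
  exact Nat.eq_of_mul_eq_mul_left hq (Nat.add_right_cancel h1)

variable [Fintype P]

/-- For an exponent `A = q B + α` with residues `α`, the shift `δ` attached to `α` moves the
quotient `B` to a point of the cone. -/
theorem exists_shifted_quotient {n q : ℕ} (A : Fin n → hibiMonoid P)
    {δ : WithBot P → Fin n → ℤ} (h0 : ∀ i, IsMax i → ∀ m, 0 ≤ δ i m)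
    (hcov : ∀ i j : WithBot P, i ⋖ j → ∀ m,
      δ j m ≤ (if (((A m).1 i % q : ℕ) : ℤ) < ((A m).1 j % q : ℕ) then 1 else 0) + δ i m) :
    ∃ E : Fin n → hibiMonoid P, ∀ m i, ((E m).1 i : ℤ) = ((A m).1 i / q : ℕ) + δ i m := by
  have : ∀ m, ∃ E : hibiMonoid P, ∀ i, (E.1 i : ℤ) = ((A m).1 i / q : ℕ) + δ i m := fun m => by
    apply exists_hibiMonoid_coe_eq
    · apply antitone_of_forall_covBy
      intro i j hij
      have h1 := hcov i j hij m
      have h2 : (A m).1 j ≤ (A m).1 i := (A m).2 hij.le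
      have h3 := Nat.div_le_div_right (c := q) h2
      by_cases h : (A m).1 i % q < (A m).1 j % q
      · -- The residue increases from `i` to `j` while the exponent does not, so the quotient drops.
        have h4 : (A m).1 j / q ≠ (A m).1 i / q := fun h4 => by
          have h5 := Nat.div_add_mod ((A m).1 j) q
          have h6 := Nat.div_add_mod ((A m).1 i) q
          rw [h4] at h5
          omega
        rw [if_pos (by exact_mod_cast h)] at h1
        omega
      · rw [if_neg (by exact_mod_cast h)] at h1
        omega
    · intro i hi
      have := h0 i hi m
      positivity
  choose E hE using this
  exact ⟨E, hE⟩

/-- The action `E` of the lift on exponents: it commutes with translation by `C` up to the factor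
`q`, and induces `q F + r ↦ F` on the sums of the exponents. -/
theorem exists_exponent_map {n q : ℕ} (hq : 0 < q) {r : hibiMonoid P}
    (H : ∀ α : WithBot P → Fin n → ℤ, (∀ i m, 0 ≤ α i m ∧ α i m < q) →
      (∀ j, ∑ m, α j m ≡ (r.1 j : ℤ) [ZMOD q]) →
      ∃ δ : WithBot P → Fin n → ℤ, (∀ i, IsMax i → ∀ m, 0 ≤ δ i m) ∧
        (∀ i j : WithBot P, i ⋖ j → ∀ m, δ j m ≤ (if α i m < α j m then 1 else 0) + δ i m) ∧
        ∀ j, (q : ℤ) * ∑ m, δ j m + r.1 j = ∑ m, α j m) :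
    ∃ E : (Fin n → hibiMonoid P) → Fin n → hibiMonoid P,
      ∀ A, IsCongruentTo q r (∑ m, A m) →
        (∀ C, E (q • C + A) = C + E A) ∧ ∑ m, A m = q • ∑ m, E A m + r := by
  -- The shift is chosen once for each matrix of residues, which makes `E` compatible with `q • C`.
  choose! δ h0 hcov hs using H
  let res : (Fin n → hibiMonoid P) → WithBot P → Fin n → ℤ := fun A i m => (((A m).1 i % q : ℕ) : ℤ)
  have hres : ∀ A i m, 0 ≤ res A i m ∧ res A i m < q := fun A i m =>
    ⟨Int.natCast_nonneg _, Int.ofNat_lt.2 (Nat.mod_lt _ hq)⟩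
  have hresr : ∀ A, IsCongruentTo q r (∑ m, A m) →
      ∀ j, ∑ m, res A j m ≡ (r.1 j : ℤ) [ZMOD q] := fun A hA j => by
    have h1 := hA j
    rw [hibiMonoid_sum_apply, Nat.ModEq, Finset.sum_nat_mod] at h1
    simp only [res]
    rw [← Nat.cast_sum, Int.natCast_modEq_iff]
    exact h1
  have hE : ∀ A : Fin n → hibiMonoid P, ∃ E : Fin n → hibiMonoid P,
      IsCongruentTo q r (∑ m, A m) →
        ∀ m i, ((E m).1 i : ℤ) = ((A m).1 i / q : ℕ) + δ (res A) i m := fun A => by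
    by_cases hA : IsCongruentTo q r (∑ m, A m)
    · obtain ⟨E, hE⟩ := exists_shifted_quotient A (h0 _ (hres A) (hresr A hA))
        (hcov _ (hres A) (hresr A hA))
      exact ⟨E, fun _ => hE⟩
    · exact ⟨0, fun h => (hA h).elim⟩
  choose E hE using hE
  refine ⟨E, fun A hA => ⟨fun C => ?_, ?_⟩⟩
  · have hCA : IsCongruentTo q r (∑ m, (q • C + A) m) := by
      have hsum : ∑ m, (q • C + A) m = q • ∑ m, C m + ∑ m, A m := by
        simp [Finset.sum_add_distrib, Finset.smul_sum]
      rwa [hsum, isCongruentTo_nsmul_add_iff]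
    have hresA : res (q • C + A) = res A := by
      funext i m
      change (((q * (C m).1 i + (A m).1 i) % q : ℕ) : ℤ) = _
      rw [Nat.mul_add_mod]
    funext m
    apply Subtype.ext
    funext i
    have h1 := hE _ hCA m i
    have h2 := hE _ hA m i
    rw [hresA] at h1
    change ((E (q • C + A) m).1 i : ℤ) =
      ((q * (C m).1 i + (A m).1 i) / q : ℕ) + δ (res A) i m at h1
    rw [Nat.mul_add_div hq] at h1
    change (E (q • C + A) m).1 i = (C m).1 i + (E A m).1 i
    omega
  · apply Subtype.ext
    funext i
    change (∑ m, A m).1 i = q * (∑ m, E A m).1 i + r.1 i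
    rw [hibiMonoid_sum_apply, hibiMonoid_sum_apply]
    have h1 := hs _ (hres A) (hresr A hA) i
    zify
    simp only [hE A hA _ i, Finset.sum_add_distrib, mul_add]
    rw [add_assoc, h1, Finset.mul_sum, ← Finset.sum_add_distrib]
    refine Finset.sum_congr rfl fun m _ => ?_
    exact (Int.natCast_inj.2 (Nat.div_add_mod ((A m).1 i) q)).symm.trans (by push_cast; rfl)

/-- The lift sends the monomial with exponents `q B + α` to the monomial with exponents `B + δ`,
where `δ` is the shift attached to the residues `α`. -/
theorem exists_mem_diagonalCartier (k : Type*) [Field k] {p n e : ℕ} [Fact p.Prime] [CharP k p]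
    {r : hibiMonoid P} (hrq : ∀ i, r.1 i < p ^ e)
    (H : ∀ α : WithBot P → Fin n → ℤ, (∀ i m, 0 ≤ α i m ∧ α i m < (p ^ e : ℕ)) →
      (∀ j, ∑ m, α j m ≡ (r.1 j : ℤ) [ZMOD (p ^ e : ℕ)]) →
      ∃ δ : WithBot P → Fin n → ℤ, (∀ i, IsMax i → ∀ m, 0 ≤ δ i m) ∧
        (∀ i j : WithBot P, i ⋖ j → ∀ m, δ j m ≤ (if α i m < α j m then 1 else 0) + δ i m) ∧
        ∀ j, ((p ^ e : ℕ) : ℤ) * ∑ m, δ j m + r.1 j = ∑ m, α j m) :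
    ∃ φ ∈ diagonalCartier k (hibiRing k P) p n e, φ (hibiBasis k r) = 1 := by
  classical
  have hq : 0 < p ^ e := pow_pos (Fact.out : p.Prime).pos e
  obtain ⟨E, hE⟩ := exists_exponent_map hq H
  set q := p ^ e
  have hF : ∀ a : hibiMonoid P, IsCongruentTo q r a → ∃ F : hibiMonoid P, a = q • F + r :=
    fun a ha => ha.exists_eq_nsmul_add hrq
  choose! F hF using hF
  have hinj := nsmul_add_right_injective hq r
  let v : (Fin n → hibiMonoid P) → TensorPow k (hibiRing k P) n := fun A =>
    if IsCongruentTo q r (∑ m, A m) then hibiTensorBasis P k n (E A) else 0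
  let w : hibiMonoid P → hibiRing k P := fun a =>
    if IsCongruentTo q r a then hibiBasis k (F a) else 0
  have hv : ∀ C A, v (q • C + A) = hibiTensorBasis P k n C * v A := fun C A => by
    have hiff : IsCongruentTo q r (∑ m, (q • C + A) m) ↔ IsCongruentTo q r (∑ m, A m) := by
      have hsum : ∑ m, (q • C + A) m = q • ∑ m, C m + ∑ m, A m := by
        simp [Finset.sum_add_distrib, Finset.smul_sum]
      rw [hsum, isCongruentTo_nsmul_add_iff]
    simp only [v]
    by_cases hA : IsCongruentTo q r (∑ m, A m)
    · rw [if_pos hA, if_pos (hiff.2 hA), (hE A hA).1, hibiTensorBasis_add]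
    · rw [if_neg hA, if_neg (mt hiff.1 hA), mul_zero]
  have hw : ∀ C a, w (q • C + a) = hibiBasis k C * w a := fun C a => by
    have hiff := isCongruentTo_nsmul_add_iff (q := q) (r := r) (C := C) (a := a)
    simp only [w]
    by_cases ha : IsCongruentTo q r a
    · have : F (q • C + a) = C + F a := hinj <| by
        dsimp only
        rw [← hF _ (hiff.2 ha), nsmul_add, add_assoc, ← hF _ ha]
      rw [if_pos ha, if_pos (hiff.2 ha), this, hibiBasis_add]
    · rw [if_neg ha, if_neg (mt hiff.1 ha), mul_zero]
  have hvw : ∀ A, diagonalMap k (hibiRing k P) n (v A) = w (∑ m, A m) := fun A => by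
    simp only [v, w]
    by_cases hA : IsCongruentTo q r (∑ m, A m)
    · have : ∑ m, E A m = F (∑ m, A m) := hinj <| by
        dsimp only
        rw [← hF _ hA, ← (hE A hA).2]
      rw [if_pos hA, if_pos hA, diagonalMap_hibiTensorBasis, this]
    · rw [if_neg hA, if_neg hA, map_zero]
  obtain ⟨φ, hφ, ψ, hψ, hψφ, hφw⟩ := exists_isRootLinear_lift (k := k) p e
    (b := hibiTensorBasis P k n) (b' := hibiBasis k) (f := diagonalMap k (hibiRing k P) n)
    (s := fun A => ∑ m, A m) (hibiTensorBasis_zero k) (hibiTensorBasis_add k) (hibiBasis_zero k)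
    (hibiBasis_add k) (diagonalMap_hibiTensorBasis k) hv hw hvw
  refine ⟨φ, ⟨hφ, ψ, hψ, hψφ⟩, ?_⟩
  have hr : IsCongruentTo q r r := fun i => rfl
  have hFr : F r = 0 := hinj <| by
    dsimp only
    rw [← hF r hr]
    simp
  rw [hφw]
  simp only [w]
  rw [if_pos hr, hFr, hibiBasis_zero]

end Sufficiency

/-! ### The criterion -/

theorem mul_add_eq_iff_eq_floor {q : ℕ} {r s N : ℤ} (hr0 : 0 ≤ r) (hrq : r < q)
    (h : s ≡ r [ZMOD q]) : q * N + r = s ↔ N = ⌊(s : ℚ) / q⌋ := by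
  have h1 : s % q = r := by rw [h.eq, Int.emod_eq_of_lt hr0 hrq]
  have h2 := Int.mul_ediv_add_emod s q
  have h3 : (q : ℤ) ≠ 0 := by omega
  rw [Rat.floor_intCast_div_natCast]
  constructor
  · intro h4
    exact mul_left_cancel₀ h3 (by omega)
  · rintro rfl
    omega

theorem mainTheorem6 {k : Type*} [Field k] (p : ℕ) [Fact p.Prime] [CharP k p]
    {P : Type*} [PartialOrder P] [Fintype P]
    (r : WithBot P → ℕ) (hr : ∀ i j : WithBot P, i ⋖ j → r j < r i)
    (n e : ℕ) (hn : 0 < n) (he : 0 < e) (hq : ∀ i, r i < p ^ e) :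
    (∃ φ ∈ diagonalCartier k (hibiRing k P) p n e, φ (hibiMonomial k r hr) = 1) ↔
      ∀ α : WithBot P → Fin n → ℤ,
        (∀ i m, 0 ≤ α i m ∧ α i m ≤ (p : ℤ) ^ e - 1) →
        (∀ j, ∑ m, α j m ≡ (r j : ℤ) [ZMOD (p : ℤ) ^ e]) →
        ∃ δ : WithBot P → Fin n → ℤ,
          (∀ v : P, IsMax v → ∀ m, 0 ≤ δ (v : WithBot P) m) ∧
          (∀ i j : WithBot P, i ⋖ j → ∀ m,
            δ j m ≤ (if α i m < α j m then 1 else 0) + δ i m) ∧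
          (∀ j, ∑ m, δ j m = ⌊∑ m, (α j m : ℚ) / (p : ℚ) ^ e⌋) := by
  let r' : hibiMonoid P := ⟨r, antitone_of_covBy_gt hr⟩
  have hz : hibiMonomial k r hr = hibiBasis k r' := (hibiBasis_apply k r').symm
  have hcast : (p : ℤ) ^ e = (p ^ e : ℕ) := by push_cast; rfl
  have hfloor : ∀ (α : WithBot P → Fin n → ℤ) (j : WithBot P) (N : ℤ),
      ∑ m, α j m ≡ (r j : ℤ) [ZMOD (p ^ e : ℕ)] →
      (((p ^ e : ℕ) : ℤ) * N + r j = ∑ m, α j m ↔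
        N = ⌊∑ m, (α j m : ℚ) / (p : ℚ) ^ e⌋) := fun α j N h => by
    rw [mul_add_eq_iff_eq_floor (Int.natCast_nonneg _) (by exact_mod_cast hq j) h,
      ← Finset.sum_div]
    push_cast
    rfl
  rw [hz, hcast]
  constructor
  · rintro ⟨φ, hφ, hφ1⟩ α hα hαr
    obtain ⟨δ, h0, hcov, hs⟩ := exists_shift_of_mem_diagonalCartier (r := r') hq hφ hφ1 α
      (fun i m => ⟨(hα i m).1, Int.le_sub_one_iff.1 (hα i m).2⟩) hαr
    refine ⟨δ, fun v hv => h0 v fun b hb => ?_, hcov, fun j => (hfloor α j _ (hαr j)).1 (hs j)⟩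
    obtain ⟨u, rfl, hu⟩ := WithBot.coe_le_iff.1 hb
    exact WithBot.coe_le_coe.2 (hv hu)
  · intro H
    refine exists_mem_diagonalCartier k (r := r') hq fun α hα hαr => ?_
    have hα' : ∀ i m, 0 ≤ α i m ∧ α i m ≤ ((p ^ e : ℕ) : ℤ) - 1 :=
      fun i m => ⟨(hα i m).1, Int.le_sub_one_iff.2 (hα i m).2⟩
    rcases isEmpty_or_nonempty P with hP | hP
    · -- Here `⊥` is maximal although it is not an element of `P`, so the signs have to be arranged
      -- by hand: all of the carry goes to one index.
      let N : WithBot P → ℤ := fun j => ⌊∑ m, (α j m : ℚ) / (p : ℚ) ^ e⌋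
      have hsub : ∀ i j : WithBot P, ¬ i ⋖ j := fun i j h => h.ne (Subsingleton.elim i j)
      have hN : ∀ j, 0 ≤ N j := fun j => Int.floor_nonneg.2 <| Finset.sum_nonneg fun m _ =>
        div_nonneg (by exact_mod_cast (hα j m).1) (by positivity)
      refine ⟨fun j m => if m = ⟨0, hn⟩ then N j else 0, fun i _ m => ?_,
        fun i j hij => (hsub i j hij).elim, fun j => (hfloor α j _ (hαr j)).2 ?_⟩
      · dsimp only
        split_ifs
        exacts [hN i, le_rfl]
      · simp [N]
    · obtain ⟨δ, h0, hcov, hs⟩ := H α hα' hαr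
      refine ⟨δ, fun i hi m => ?_, hcov, fun j => (hfloor α j _ (hαr j)).2 (hs j)⟩
      induction i with
      | bot =>
        obtain ⟨v⟩ := hP
        exact absurd (hi (bot_le (a := (v : WithBot P)))) (WithBot.not_coe_le_bot v)
      | coe v => exact h0 v (fun b hb => WithBot.coe_le_coe.1 (hi (WithBot.coe_le_coe.2 hb))) m
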